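/- Let $P$ be a poset, regarded as a category with a unique morphism $p\to q$ whenever $p\le q$. Let $X$ be the dcpo of filters on $P$ (nonempty, downward directed, upward closed subsets), ordered by inclusion and equipped with the Scott topology. For $p\in P$ let ${\uparrow}p\in X$ be the principal filter and $(p)=\{x\in X : {\uparrow}p\le x\}$; for a sieve $L$ on $p$ let $\widetilde L=\{x\in X : {\uparrow}q\le x \text{ for some } q\in L\}$, an open subset of $X$. Let $\mathcal P(X)$ be the poset of subsets of $X$ and $\mathrm{GT}(P)$ the poset of Grothendieck topologies on $P$, both ordered by inclusion. The strong topology on $X$ is the topology with the locally closed subsets of $X$ as a basis. For $Y\subseteq X$ let $K_Y$ be the Grothendieck topology on $P$ corresponding to the sublocale of $\mathcal O(X)$ given by the frame homomorphism $\mathcal O(X)\to\mathcal O(Y)$, $U\mapsto U\cap Y$ (a sieve $L$ on $p$ covers if and only if $(p)$ and $\widetilde L$ have the same image in $\mathcal O(Y)$). For a Grothendieck topology $J$ on $P$ let $S_J\subseteq X$ be the set of points of the topos $\mathsf{Sh}(P,J)$, where a point, given by its fiber functor $F:P\to\mathsf{Set}$, is identified with the filter $\{p\in P : F(p)\neq\varnothing\}$.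 Then: 1. For every $Y\subseteq X$ and $p\in P$, $K_Y(p)=\{L \text{ a sieve on } p : \widetilde L\supseteq (p)\cap Y\}$. 2. For every $J\in\mathrm{GT}(P)$, $S_J=\{x\in X : \text{for all } p\in P,\ {\uparrow}p\le x \Rightarrow x\in\bigcap_{L\in J(p)}\widetilde L\}$. 3. $K:\mathcal P(X)\to\mathrm{GT}(P)^{\mathrm{op}}$ is left adjoint to $S:\mathrm{GT}(P)^{\mathrm{op}}\to\mathcal P(X)$: for all $Y$ and $J$, $J\subseteq K_Y$ if and only if $Y\subseteq S_J$. 4. $K$ and $S$ restrict to mutually inverse order isomorphisms $\mathcal V(X)\simeq\mathrm{GT}_{\mathrm{ep}}(P)^{\mathrm{op}}$ between the poset $\mathcal V(X)$ of subsets of $X$ that are closed in the strong topology and the opposite of the poset $\mathrm{GT}_{\mathrm{ep}}(P)$ of Grothendieck topologies $J$ such that $\mathsf{Sh}(P,J)$ has enough points. 5. $\mathcal V(X)$ is the image of $S$, and $\mathrm{GT}_{\mathrm{ep}}(P)$ is the image of $K$. 6. A subset of $X$ belongs to $\mathcal V(X)$ if and only if, with the subspace topology, it is a sober space. -/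

import Mathlib

open CategoryTheory TopologicalSpace
open Order (PFilter)
open scoped Topology

universe u v

namespace PosetTopology

/-- The set of filters on `P`, ordered by inclusion, with the Scott topology. -/
instance scottPFilter (P : Type u) [PartialOrder P] : TopologicalSpace (PFilter P) :=
  Topology.scott (PFilter P) Set.univ

instance isScottPFilter (P : Type u) [PartialOrder P] :
    Topology.IsScott (PFilter P) Set.univ := ⟨rfl⟩

/-- The strong topology of a topological space: it is generated by the locally closed subsets
(these are stable under finite intersections, so they form a basis). -/
@[reducible] def strongTopology (X : Type u) [TopologicalSpace X] : TopologicalSpace X :=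
  generateFrom {s : Set X | IsLocallyClosed s}

variable {P : Type u} [PartialOrder P]

theorem isOpen_Ici_principal (p : P) : IsOpen (Set.Ici (PFilter.principal p)) := by
  rw [Topology.IsScott.isOpen_iff_isUpperSet_and_dirSupInaccOn (D := Set.univ)]
  refine ⟨isUpperSet_Ici _, ?_⟩
  intro d _ hne hd x hx hp
  by_contra hcon
  have hno : ∀ y ∈ d, p ∉ y := fun y hy hpy =>
    hcon ⟨y, hy, PFilter.principal_le_iff.2 hpy⟩
  have hfil : Order.IsPFilter (⋃ y ∈ d, (y : Set P)) := by
    refine Order.IsPFilter.of_def ?_ ?_ ?_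
    · obtain ⟨y, hy⟩ := hne
      obtain ⟨a, ha⟩ := y.nonempty
      exact ⟨a, Set.mem_biUnion hy ha⟩
    · intro a ha b hb
      simp only [Set.mem_iUnion] at ha hb
      obtain ⟨y, hy, hay⟩ := ha
      obtain ⟨z, hz, hbz⟩ := hb
      obtain ⟨w, hw, hyw, hzw⟩ := hd y hy z hz
      obtain ⟨c, hc, hca, hcb⟩ := w.directed a (hyw hay) b (hzw hbz)
      exact ⟨c, Set.mem_biUnion hw hc, hca, hcb⟩
    · intro a b hab ha
      simp only [Set.mem_iUnion] at ha ⊢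
      obtain ⟨y, hy, hay⟩ := ha
      exact ⟨y, hy, PFilter.mem_of_le hab hay⟩
  have hle : x ≤ hfil.toPFilter := hx.2 (fun y hy a ha => Set.mem_biUnion hy ha)
  have hmem : p ∈ (⋃ y ∈ d, (y : Set P)) := hle (PFilter.principal_le_iff.1 hp)
  simp only [Set.mem_iUnion] at hmem
  obtain ⟨y, hy, hpy⟩ := hmem
  exact hno y hy hpy

/-- The open set `(p)` of all filters above the principal filter of `p`. -/
def principalOpen (p : P) : Opens (PFilter P) :=
  ⟨Set.Ici (PFilter.principal p), isOpen_Ici_principal p⟩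

/-- The underlying subset of `P` of a sieve on `p`. -/
def sieveSet {p : P} (L : Sieve p) : Set P := {q | ∃ f : q ⟶ p, L f}

/-- The open set generated by a sieve `L`: the upward closure in the poset of filters of the set
of principal filters of elements of `L`. -/
def sieveOpen {p : P} (L : Sieve p) : Opens (PFilter P) where
  carrier := upperClosure (PFilter.principal '' sieveSet L)
  is_open' := by
    rw [coe_upperClosure]
    refine isOpen_biUnion ?_
    rintro _ ⟨q, _, rfl⟩
    exact isOpen_Ici_principal q

theorem mem_principalOpen {p : P} {x : PFilter P} : x ∈ principalOpen p ↔ p ∈ x :=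
  PFilter.principal_le_iff

theorem mem_sieveOpen {p : P} {L : Sieve p} {x : PFilter P} :
    x ∈ sieveOpen L ↔ ∃ q, ∃ f : q ⟶ p, L f ∧ q ∈ x := by
  change x ∈ upperClosure (PFilter.principal '' sieveSet L) ↔ _
  rw [mem_upperClosure]
  constructor
  · rintro ⟨_, ⟨q, ⟨f, hf⟩, rfl⟩, hq⟩
    exact ⟨q, f, hf, PFilter.principal_le_iff.1 hq⟩
  · rintro ⟨q, f, hf, hq⟩
    exact ⟨_, ⟨q, ⟨f, hf⟩, rfl⟩, PFilter.principal_le_iff.2 hq⟩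

/-- The Grothendieck topology on `P` corresponding to a map of locales into the locale of opens
of the space of filters, given by its frame homomorphism `f`: a sieve `L` on `p` covers
if and only if `f` turns the inclusion of the open set generated by `L` into `(p)` into an
equality. -/
def topologyOfFrameHom {F : Type v} [Order.Frame F] (f : FrameHom (Opens (PFilter P)) F) :
    GrothendieckTopology P where
  sieves p := {L | f (principalOpen p) ≤ f (sieveOpen L)}
  top_mem' p := OrderHomClass.mono f fun x hx =>
    mem_sieveOpen.2 ⟨p, 𝟙 p, trivial, mem_principalOpen.1 hx⟩
  pullback_stable' p q S g hS := by
    have h1 : f (principalOpen q) ≤ f (principalOpen p) := OrderHomClass.mono f fun x hx =>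
      mem_principalOpen.2 (PFilter.mem_of_le g.le (mem_principalOpen.1 hx))
    have h2 : f (principalOpen q) ≤ f (sieveOpen S ⊓ principalOpen q) := by
      rw [map_inf]
      exact le_inf (h1.trans hS) le_rfl
    refine h2.trans (OrderHomClass.mono f ?_)
    rintro x ⟨hxS, hxq⟩
    obtain ⟨r, k, hk, hr⟩ := mem_sieveOpen.1 hxS
    obtain ⟨s, hs, hsr, hsq⟩ := x.directed r hr q (mem_principalOpen.1 hxq)
    refine mem_sieveOpen.2 ⟨s, homOfLE hsq, ?_, hs⟩
    change S (homOfLE hsq ≫ g)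
    have := S.downward_closed hk (homOfLE hsr)
    rwa [Subsingleton.elim (homOfLE hsq ≫ g) (homOfLE hsr ≫ k)]
  transitive' p S hS R hR := by
    refine le_trans hS ?_
    have hle : sieveOpen S ≤ ⨆ q : {q : P // ∃ k : q ⟶ p, S k}, principalOpen q.1 := by
      intro x hx
      obtain ⟨q, k, hk, hq⟩ := mem_sieveOpen.1 hx
      exact Opens.mem_iSup.2 ⟨⟨q, k, hk⟩, mem_principalOpen.2 hq⟩
    refine (OrderHomClass.mono f hle).trans ?_
    rw [map_iSup]
    refine iSup_le ?_
    rintro ⟨q, k, hk⟩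
    refine le_trans (hR hk) (OrderHomClass.mono f ?_)
    intro x hx
    obtain ⟨r, l, hl, hr⟩ := mem_sieveOpen.1 hx
    exact mem_sieveOpen.2 ⟨r, l ≫ k, hl, hr⟩

/-- `K_Y`: the Grothendieck topology corresponding to the sublocale of opens of the subspace `Y`,
that is, to the frame homomorphism `U ↦ U ∩ Y`. -/
def K (Y : Set (PFilter P)) : GrothendieckTopology P :=
  topologyOfFrameHom (Opens.comap (⟨Subtype.val, continuous_subtype_val⟩ : C(Y, PFilter P)))

/-- The filter on `P` corresponding to a point of the topos of sheaves on `(P, J)`, such a point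
being given by its fiber functor on `P`: it consists of the elements with nonempty fiber. -/
def pointFilter {J : GrothendieckTopology P} (Φ : GrothendieckTopology.Point.{u} J) :
    PFilter P :=
  Order.IsPFilter.toPFilter (F := {p : P | Nonempty (Φ.fiber.obj p)}) <| by
    refine Order.IsPFilter.of_def ?_ ?_ ?_
    · obtain ⟨⟨p, x⟩⟩ := (IsCofiltered.nonempty : Nonempty Φ.fiber.Elements)
      exact ⟨p, ⟨x⟩⟩
    · rintro p ⟨x⟩ q ⟨y⟩
      let a : Φ.fiber.Elements := ⟨p, x⟩
      let b : Φ.fiber.Elements := ⟨q, y⟩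
      exact ⟨(IsCofiltered.min a b).1, ⟨(IsCofiltered.min a b).2⟩,
        (IsCofiltered.minToLeft a b).1.le, (IsCofiltered.minToRight a b).1.le⟩
    · rintro p q hpq ⟨x⟩
      exact ⟨Φ.fiber.map (homOfLE hpq) x⟩

/-- `S_J`: the set of points of the topos of sheaves on `(P, J)`, as a set of filters. -/
def S (J : GrothendieckTopology P) : Set (PFilter P) :=
  Set.range (pointFilter (J := J))

end PosetTopology

open PosetTopology

namespace PosetTopology

/-! ### Basic open sets of the space of filters -/

section Space

variable {P : Type u} [PartialOrder P]

/-! Every filter is the directed supremum of the principal filters of its elements, so the sets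
`(p)` form a basis of the Scott topology. Both `K` and `S` come from one relation between a filter
`x` and a sieve `L` on `p`: if `p ∈ x`, then `x` meets `L` (`mem_K_iff`, `mem_S_iff`). The Galois
connection is therefore formal, and the work lies in finding its fixed points.

Each `S J` is an intersection of complements of locally closed sets. Conversely, a filter outside a
strongly closed `Y` lies in some `(p) \ W` disjoint from `Y`, with `W` open. The elements below `p`
whose basic open lies in `W` form a `K Y`-covering sieve that the filter misses, so `S (K Y) = Y`.
On the other side, having enough points says that the covering sieves are those detected by a family
of filters, i.e. that `J` is some `K Y`.

For sobriety, the union of an irreducible closed family in `Y` is a filter in `S (K Y)` and its only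
possible generic point. Conversely, each `x ∈ S (K Y)` is the generic point of `{y ∈ Y | y ≤ x}`. -/

theorem exists_Ici_principal_subset {U : Set (PFilter P)} (hU : IsOpen U) {x : PFilter P}
    (hx : x ∈ U) : ∃ p ∈ x, Set.Ici (PFilter.principal p) ⊆ U := by
  rw [Topology.IsScott.isOpen_iff_isUpperSet_and_dirSupInaccOn (D := Set.univ)] at hU
  obtain ⟨hup, hin⟩ := hU
  have hne : (PFilter.principal '' (x : Set P)).Nonempty := x.nonempty.image _
  have hdir : DirectedOn (· ≤ ·) (PFilter.principal '' (x : Set P)) := by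
    rintro _ ⟨a, ha, rfl⟩ _ ⟨b, hb, rfl⟩
    obtain ⟨c, hc, hca, hcb⟩ := x.directed a ha b hb
    exact ⟨_, ⟨c, hc, rfl⟩, PFilter.antitone_principal hca, PFilter.antitone_principal hcb⟩
  have hlub : IsLUB (PFilter.principal '' (x : Set P)) x := by
    refine ⟨?_, fun y hy p hp => PFilter.principal_le_iff.1 (hy ⟨p, hp, rfl⟩)⟩
    rintro _ ⟨a, ha, rfl⟩
    exact PFilter.principal_le_iff.2 ha
  obtain ⟨_, ⟨p, hp, rfl⟩, hpU⟩ := hin (Set.mem_univ _) hne hdir hlub hx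
  exact ⟨p, hp, fun y hy => hup hy hpU⟩

theorem isOpen_not_le (x : PFilter P) : IsOpen {y : PFilter P | ¬ y ≤ x} := by
  rw [isOpen_iff_forall_mem_open]
  intro y hy
  obtain ⟨p, hpy, hpx⟩ := Set.not_subset.1 hy
  exact ⟨_, fun z hz hzx => hpx (hzx (PFilter.principal_le_iff.1 hz)),
    isOpen_Ici_principal p, PFilter.principal_le_iff.2 hpy⟩

instance : T0Space (PFilter P) where
  t0 x y h := by
    have key : ∀ {x y : PFilter P}, Inseparable x y → x ≤ y := fun h p hp =>
      PFilter.principal_le_iff.1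
        ((h.mem_open_iff (isOpen_Ici_principal p)).1 (PFilter.principal_le_iff.2 hp))
    exact le_antisymm (key h) (key h.symm)

/-- The sieve on `p` of all elements below `p` whose basic open set is contained in `W`. -/
def sieveBelow (p : P) (W : Set (PFilter P)) : Sieve p where
  arrows q _ := Set.Ici (PFilter.principal q) ⊆ W
  downward_closed h g :=
    (Set.Ici_subset_Ici.2 (PFilter.antitone_principal g.le)).trans h

/-- Strongly open sets are unions of sets of the form `(p) \ W` with `W` open. -/
theorem exists_diff_subset_of_isOpen_strongTopology {V : Set (PFilter P)}
    (hV : IsOpen[strongTopology (PFilter P)] V) {x : PFilter P} (hx : x ∈ V) :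
    ∃ p ∈ x, ∃ W : Set (PFilter P), IsOpen W ∧ x ∉ W ∧
      Set.Ici (PFilter.principal p) \ W ⊆ V := by
  induction hV with
  | basic s hs =>
    obtain ⟨U, Z, hU, hZ, rfl⟩ := hs
    obtain ⟨p, hp, hpU⟩ := exists_Ici_principal_subset hU hx.1
    exact ⟨p, hp, Zᶜ, hZ.isOpen_compl, fun h => h hx.2,
      fun y hy => ⟨hpU hy.1, not_not.1 hy.2⟩⟩
  | univ =>
    obtain ⟨p, hp⟩ := x.nonempty
    exact ⟨p, hp, ∅, isOpen_empty, id, Set.subset_univ _⟩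
  | inter s t _ _ hs ht =>
    obtain ⟨p, hp, W, hW, hxW, hpW⟩ := hs hx.1
    obtain ⟨q, hq, W', hW', hxW', hqW'⟩ := ht hx.2
    obtain ⟨r, hr, hrp, hrq⟩ := x.directed p hp q hq
    refine ⟨r, hr, W ∪ W', hW.union hW', fun h => h.elim hxW hxW', fun y hy => ⟨?_, ?_⟩⟩
    · exact hpW ⟨(PFilter.antitone_principal hrp).trans hy.1, fun h => hy.2 (Or.inl h)⟩
    · exact hqW' ⟨(PFilter.antitone_principal hrq).trans hy.1, fun h => hy.2 (Or.inr h)⟩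
  | sUnion T _ ih =>
    obtain ⟨t, ht, hxt⟩ := hx
    obtain ⟨p, hp, W, hW, hxW, hpW⟩ := ih t ht hxt
    exact ⟨p, hp, W, hW, hxW, hpW.trans (Set.subset_sUnion_of_mem ht)⟩

theorem mem_K_iff {Y : Set (PFilter P)} {p : P} {L : Sieve p} :
    L ∈ K Y p ↔ ∀ y ∈ Y, p ∈ y → ∃ q, ∃ f : q ⟶ p, L f ∧ q ∈ y :=
  ⟨fun h y hy hp => mem_sieveOpen.1 (h (show (⟨y, hy⟩ : Y) ∈ _ from mem_principalOpen.2 hp)),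
    fun h y hy => mem_sieveOpen.2 (h y.1 y.2 (mem_principalOpen.1 hy))⟩

theorem sieveBelow_mem_K {Y W : Set (PFilter P)} {p : P} (hW : IsOpen W)
    (h : Set.Ici (PFilter.principal p) ∩ Y ⊆ W) : sieveBelow p W ∈ K Y p := by
  refine mem_K_iff.2 fun y hy hp => ?_
  obtain ⟨q, hq, hqW⟩ := exists_Ici_principal_subset hW (h ⟨PFilter.principal_le_iff.2 hp, hy⟩)
  obtain ⟨r, hr, hrp, hrq⟩ := y.directed p hp q hq
  exact ⟨r, homOfLE hrp,
    (Set.Ici_subset_Ici.2 (PFilter.antitone_principal hrq)).trans hqW, hr⟩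

end Space

/-! ### Points as filters, and the fixed points of the adjunction -/

section Points

variable {P : Type u} [PartialOrder P] {J : GrothendieckTopology P}

theorem mem_pointFilter {Φ : GrothendieckTopology.Point.{u} J} {p : P} :
    p ∈ pointFilter Φ ↔ Nonempty (Φ.fiber.obj p) := Iff.rfl

/-- Two elements of a fiber are images of a single one, by cofilteredness, under parallel arrows of
`P`, and these coincide. -/
theorem subsingleton_fiber (Φ : GrothendieckTopology.Point.{u} J) (p : P) :
    Subsingleton (Φ.fiber.obj p) := by
  refine ⟨fun x y => ?_⟩
  let a : Φ.fiber.Elements := ⟨p, x⟩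
  let b : Φ.fiber.Elements := ⟨p, y⟩
  have hx := (IsCofiltered.minToLeft a b).2
  have hy := (IsCofiltered.minToRight a b).2
  rw [← show _ = x from hx, ← show _ = y from hy]
  exact congrArg (Φ.fiber.map · (IsCofiltered.min a b).2) (Subsingleton.elim _ _)

/-- The indicator functor of a filter. -/
def indicatorFunctor (x : PFilter P) : P ⥤ Type u where
  obj p := ULift (PLift (p ∈ x))
  map f := ↾fun h => ⟨⟨PFilter.mem_of_le f.le h.down.down⟩⟩

instance (x : PFilter P) (p : P) : Subsingleton ((indicatorFunctor x).obj p) :=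
  inferInstanceAs (Subsingleton (ULift (PLift (p ∈ x))))

instance (x : PFilter P) : IsCofiltered (indicatorFunctor x).Elements where
  nonempty := by
    obtain ⟨p, hp⟩ := x.nonempty
    exact ⟨⟨p, ⟨⟨hp⟩⟩⟩⟩
  cone_objs := by
    rintro ⟨p, hp⟩ ⟨q, hq⟩
    obtain ⟨r, hr, hrp, hrq⟩ := x.directed p hp.down.down q hq.down.down
    exact ⟨⟨r, ⟨⟨hr⟩⟩⟩, ⟨homOfLE hrp, Subsingleton.elim _ _⟩,
      ⟨homOfLE hrq, Subsingleton.elim _ _⟩, trivial⟩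
  cone_maps a b f g := ⟨a, 𝟙 a, by rw [Subtype.ext (Subsingleton.elim f.1 g.1)]⟩

/-- The point of the topos of sheaves on `(P, J)` given by a filter that meets every covering
sieve of each of its elements. -/
def pointOfFilter (x : PFilter P)
    (hx : ∀ p ∈ x, ∀ L ∈ J p, ∃ q, ∃ f : q ⟶ p, L f ∧ q ∈ x) :
    GrothendieckTopology.Point.{u} J where
  fiber := indicatorFunctor x
  initiallySmall := initiallySmall_of_small_weakly_initial_set Set.univ
    fun a => ⟨a, trivial, ⟨𝟙 a⟩⟩
  jointly_surjective {p} L hL a := by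
    obtain ⟨q, f, hf, hq⟩ := hx p a.down.down L hL
    exact ⟨q, f, hf, ⟨⟨hq⟩⟩, Subsingleton.elim _ _⟩

theorem pointFilter_pointOfFilter (x : PFilter P)
    (hx : ∀ p ∈ x, ∀ L ∈ J p, ∃ q, ∃ f : q ⟶ p, L f ∧ q ∈ x) :
    pointFilter (pointOfFilter x hx) = x :=
  SetLike.ext fun _ => mem_pointFilter.trans ⟨fun ⟨h⟩ => h.down.down, fun h => ⟨⟨⟨h⟩⟩⟩⟩

theorem mem_S_iff {x : PFilter P} :
    x ∈ S J ↔ ∀ p ∈ x, ∀ L ∈ J p, ∃ q, ∃ f : q ⟶ p, L f ∧ q ∈ x := by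
  refine ⟨?_, fun h => ⟨_, pointFilter_pointOfFilter x h⟩⟩
  rintro ⟨Φ, rfl⟩ p ⟨a⟩ L hL
  obtain ⟨q, f, hf, b, -⟩ := Φ.jointly_surjective L hL a
  exact ⟨q, f, hf, ⟨b⟩⟩

theorem le_K_iff_subset_S {Y : Set (PFilter P)} : J ≤ K Y ↔ Y ⊆ S J :=
  ⟨fun h y hy => mem_S_iff.2 fun p hp _ hL => mem_K_iff.1 (h p hL) y hy hp,
    fun h _ L hL => mem_K_iff.2 fun _ hy hp => mem_S_iff.1 (h hy) _ hp L hL⟩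

theorem gc_K_S : GaloisConnection
    (fun Y : Set (PFilter P) => OrderDual.toDual (K Y))
    (fun J : (GrothendieckTopology P)ᵒᵈ => S (OrderDual.ofDual J)) :=
  fun _ _ => le_K_iff_subset_S

variable (J) in
theorem isClosed_strongTopology_S : IsClosed[strongTopology (PFilter P)] (S J) := by
  have : S J = ⋂ (p : P) (L ∈ J p),
      (Set.Ici (PFilter.principal p) ∩ (sieveOpen L : Set (PFilter P))ᶜ)ᶜ := by
    ext x
    simp only [mem_S_iff, Set.mem_iInter, Set.mem_compl_iff, Set.mem_inter_iff, Set.mem_Ici,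
      PFilter.principal_le_iff, SetLike.mem_coe, mem_sieveOpen, not_and, not_not]
    exact ⟨fun h p L hL hp => h p hp L hL, fun h p hp L hL => h p L hL hp⟩
  have hlc (p : P) (L : Sieve p) : IsLocallyClosed
      (Set.Ici (PFilter.principal p) ∩ (sieveOpen L : Set (PFilter P))ᶜ) :=
    ⟨_, _, isOpen_Ici_principal p, (sieveOpen L).isOpen.isClosed_compl, rfl⟩
  rw [this]
  exact @isClosed_iInter _ _ (strongTopology _) _ fun p =>
    @isClosed_iInter _ _ (strongTopology _) _ fun L =>
    @isClosed_iInter _ _ (strongTopology _) _ fun _ =>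
    @IsOpen.isClosed_compl _ (strongTopology _) _ (isOpen_generateFrom_of_mem (hlc p L))

theorem S_K_of_isClosed {Y : Set (PFilter P)} (hY : IsClosed[strongTopology (PFilter P)] Y) :
    S (K Y) = Y := by
  refine Set.Subset.antisymm (fun x hx => ?_) (le_K_iff_subset_S.1 le_rfl)
  by_contra hxY
  obtain ⟨p, hp, W, hW, hxW, hpW⟩ :=
    exists_diff_subset_of_isOpen_strongTopology hY.isOpen_compl hxY
  obtain ⟨q, f, hf, hq⟩ := mem_S_iff.1 hx p hp _
    (sieveBelow_mem_K hW fun y hy => by_contra fun h => hpW ⟨hy.1, h⟩ hy.2)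
  exact hxW (hf (PFilter.principal_le_iff.2 hq))

theorem range_S : Set.range (fun J : GrothendieckTopology P => S J) =
    {Y | IsClosed[strongTopology (PFilter P)] Y} :=
  Set.Subset.antisymm (Set.range_subset_iff.2 isClosed_strongTopology_S)
    fun Y hY => ⟨K Y, S_K_of_isClosed hY⟩

theorem hasEnoughPoints_K (Y : Set (PFilter P)) :
    GrothendieckTopology.HasEnoughPoints.{u} (K Y) := by
  have hY : ∀ y : Y, ∀ p ∈ y.1, ∀ L ∈ K Y p, ∃ q, ∃ f : q ⟶ p, L f ∧ q ∈ y.1 :=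
    fun y p hp L hL => mem_K_iff.1 hL y y.2 hp
  refine ⟨⟨ObjectProperty.ofObj fun y : Y => pointOfFilter y.1 (hY y), inferInstance, ?_⟩⟩
  refine .mk' fun p L hL => mem_K_iff.2 fun y hy hp => ?_
  obtain ⟨q, f, hf, hq, -⟩ := hL ⟨_, ObjectProperty.ofObj_apply _ ⟨y, hy⟩⟩ ⟨⟨hp⟩⟩
  exact ⟨q, f, hf, hq.down.down⟩

theorem exists_K_eq (hJ : GrothendieckTopology.HasEnoughPoints.{u} J) :
    ∃ Y : Set (PFilter P), K Y = J := by
  obtain ⟨C, _, hC⟩ := hJ.exists_objectProperty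
  refine ⟨{x | ∃ Φ, C Φ ∧ pointFilter Φ = x}, le_antisymm (fun p L hL => ?_) ?_⟩
  -- Joint reflection is applied to `L` written as generated by a family; its index needs only the
  -- domains, since arrows of `P` are unique.
  · rw [← show Sieve.ofArrows (fun i : {q : P // ∃ f : q ⟶ p, L f} => i.1)
        (fun i => i.2.choose) = L from ?_, hC.jointly_reflect_ofArrows_mem]
    · intro Φ x
      obtain ⟨q, f, hf, ⟨y⟩⟩ := mem_K_iff.1 hL _ ⟨Φ.1, Φ.2, rfl⟩ ⟨x⟩
      have := subsingleton_fiber Φ.obj p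
      exact ⟨⟨q, f, hf⟩, y, Subsingleton.elim _ _⟩
    · refine le_antisymm ?_ fun q f hf => ?_
      · rw [Sieve.generate_le_iff, Presieve.ofArrows_le_iff]
        exact fun i => i.2.choose_spec
      · rw [Subsingleton.elim f (Exists.choose (⟨f, hf⟩ : ∃ f : q ⟶ p, L f))]
        exact Sieve.ofArrows_mk _ (fun i : {q : P // ∃ f : q ⟶ p, L f} => i.2.choose)
          ⟨q, f, hf⟩
  · refine le_K_iff_subset_S.2 ?_
    rintro _ ⟨Φ, -, rfl⟩
    exact ⟨Φ, rfl⟩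

theorem range_K : Set.range (fun Y : Set (PFilter P) => K Y) =
    {J | GrothendieckTopology.HasEnoughPoints.{u} J} :=
  Set.Subset.antisymm (Set.range_subset_iff.2 hasEnoughPoints_K) fun _ hJ => exists_K_eq hJ

theorem K_S_of_hasEnoughPoints (hJ : GrothendieckTopology.HasEnoughPoints.{u} J) :
    K (S J) = J := by
  obtain ⟨Y, rfl⟩ := exists_K_eq hJ
  exact gc_K_S.l_u_l_eq_l Y

variable (P) in
/-- The order isomorphism between strongly closed sets of filters and Grothendieck topologies
with enough points. -/
def closedOrderIso :
    {Y : Set (PFilter P) // IsClosed[strongTopology (PFilter P)] Y} ≃o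
      {J : GrothendieckTopology P // GrothendieckTopology.HasEnoughPoints.{u} J}ᵒᵈ where
  toFun Y := OrderDual.toDual ⟨K Y.1, hasEnoughPoints_K Y.1⟩
  invFun J := ⟨S (OrderDual.ofDual J).1, isClosed_strongTopology_S _⟩
  left_inv Y := Subtype.ext (S_K_of_isClosed Y.2)
  right_inv J := Subtype.ext (K_S_of_hasEnoughPoints (OrderDual.ofDual J).2)
  map_rel_iff' {Y Z} := by
    change K Z.1 ≤ K Y.1 ↔ Y.1 ⊆ Z.1
    rw [le_K_iff_subset_S, S_K_of_isClosed Z.2]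

end Points

/-! ### Sober subspaces -/

section Sober

variable {P : Type u} [PartialOrder P] {Y : Set (PFilter P)}

theorem quasiSober_of_S_K_eq (hY : S (K Y) = Y) : QuasiSober Y := by
  refine ⟨fun {F} hF hFc => ?_⟩
  have hopen : ∀ p : P, IsOpen {y : Y | p ∈ y.1} := fun p => by
    simpa only [Set.preimage, Set.mem_Ici, PFilter.principal_le_iff] using
      (isOpen_Ici_principal p).preimage (continuous_subtype_val (p := (· ∈ Y)))
  have hfil : Order.IsPFilter {p : P | ∃ y ∈ F, p ∈ y.1} := by
    refine Order.IsPFilter.of_def ?_ ?_ ?_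
    · obtain ⟨y, hy⟩ := hF.nonempty
      obtain ⟨p, hp⟩ := y.1.nonempty
      exact ⟨p, y, hy, hp⟩
    · rintro p ⟨y, hy, hp⟩ q ⟨z, hz, hq⟩
      -- Irreducibility puts `p` and `q` in a single member of `F`, which makes the union of `F`
      -- downward directed.
      obtain ⟨w, hw, hwp, hwq⟩ := hF.2 _ _ (hopen p) (hopen q) ⟨y, hy, hp⟩ ⟨z, hz, hq⟩
      obtain ⟨r, hr, hrp, hrq⟩ := w.1.directed p hwp q hwq
      exact ⟨r, ⟨w, hw, hr⟩, hrp, hrq⟩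
    · rintro p q hpq ⟨y, hy, hp⟩
      exact ⟨y, hy, PFilter.mem_of_le hpq hp⟩
  have hmem : ∀ p, p ∈ hfil.toPFilter ↔ ∃ y ∈ F, p ∈ y.1 := fun _ => Iff.rfl
  have hxY : hfil.toPFilter ∈ Y := by
    refine hY.le (mem_S_iff.2 fun p hp L hL => ?_)
    obtain ⟨y, hy, hpy⟩ := (hmem p).1 hp
    obtain ⟨q, f, hf, hq⟩ := mem_K_iff.1 hL y.1 y.2 hpy
    exact ⟨q, f, hf, (hmem q).2 ⟨y, hy, hq⟩⟩
  refine ⟨⟨_, hxY⟩, Set.Subset.antisymm ?_ fun y hy => ?_⟩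
  · refine closure_minimal (Set.singleton_subset_iff.2 (by_contra fun hx => ?_)) hFc
    obtain ⟨U, hU, hUF⟩ := isOpen_induced_iff.1 hFc.isOpen_compl
    have hxU : hfil.toPFilter ∈ U := by rwa [← Set.mem_compl_iff, ← hUF] at hx
    obtain ⟨p, hp, hpU⟩ := exists_Ici_principal_subset hU hxU
    obtain ⟨y, hy, hpy⟩ := (hmem p).1 hp
    have : y ∈ Fᶜ := hUF ▸ (hpU (PFilter.principal_le_iff.2 hpy) : y.1 ∈ U)
    exact this hy
  · rw [mem_closure_iff]
    intro V hV hyV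
    obtain ⟨U, hU, rfl⟩ := isOpen_induced_iff.1 hV
    obtain ⟨p, hp, hpU⟩ := exists_Ici_principal_subset hU hyV
    exact ⟨_, hpU (PFilter.principal_le_iff.2 ((hmem p).2 ⟨y, hy, hp⟩)), rfl⟩

theorem S_K_eq_of_quasiSober [QuasiSober Y] : S (K Y) = Y := by
  refine Set.Subset.antisymm (fun x hx => ?_) (le_K_iff_subset_S.1 le_rfl)
  have hmeet : ∀ p ∈ x, ∃ y : Y, y.1 ≤ x ∧ p ∈ y.1 := by
    intro p hp
    by_contra! hcon
    -- Otherwise every `y ∈ Y` containing `p` lies in the open set `{y | ¬ y ≤ x}`. The resulting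
    -- covering sieve meets `x`, which forces `¬ x ≤ x`.
    obtain ⟨q, f, hf, hq⟩ := mem_S_iff.1 hx p hp _ (sieveBelow_mem_K (isOpen_not_le x)
      fun y hy hyx => hcon ⟨y, hy.2⟩ hyx (PFilter.principal_le_iff.1 hy.1))
    exact hf (PFilter.principal_le_iff.2 hq : x ∈ _) le_rfl
  have hclosed : IsClosed {y : Y | y.1 ≤ x} := by
    rw [← isOpen_compl_iff]
    exact (isOpen_not_le x).preimage continuous_subtype_val
  have hirr : IsIrreducible {y : Y | y.1 ≤ x} := by
    refine ⟨?_, ?_⟩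
    · obtain ⟨p, hp⟩ := x.nonempty
      obtain ⟨y, hy, -⟩ := hmeet p hp
      exact ⟨y, hy⟩
    · rintro _ _ ⟨U, hU, rfl⟩ ⟨V, hV, rfl⟩ ⟨y, hy, hyU⟩ ⟨z, hz, hzV⟩
      obtain ⟨p, hp, hpU⟩ := exists_Ici_principal_subset hU hyU
      obtain ⟨q, hq, hqV⟩ := exists_Ici_principal_subset hV hzV
      obtain ⟨r, hr, hrp, hrq⟩ := x.directed p (hy hp) q (hz hq)
      obtain ⟨w, hw, hrw⟩ := hmeet r hr
      exact ⟨w, hw, hpU (PFilter.principal_le_iff.2 (PFilter.mem_of_le hrp hrw)),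
        hqV (PFilter.principal_le_iff.2 (PFilter.mem_of_le hrq hrw))⟩
  obtain ⟨y, hy⟩ := QuasiSober.sober hirr hclosed
  -- The generic point `y` lies in every open set meeting `{z ∈ Y | z ≤ x}`, hence in `(p)` for each
  -- `p ∈ x`.
  have hxy : x ≤ y.1 := by
    intro p hp
    obtain ⟨z, hz, hpz⟩ := hmeet p hp
    exact PFilter.principal_le_iff.1 ((hy.specializes hz).mem_open
      ((isOpen_Ici_principal p).preimage continuous_subtype_val)
      (PFilter.principal_le_iff.2 hpz))
  rw [le_antisymm hxy hy.mem]
  exact y.2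

end Sober

end PosetTopology

theorem mainTheorem1 (P : Type u) [PartialOrder P] :
    -- explicit formulas for `K` and `S`
    (∀ (Y : Set (PFilter P)) (p : P) (L : Sieve p),
      L ∈ K Y p ↔ Set.Ici (PFilter.principal p) ∩ Y ⊆
        (upperClosure (PFilter.principal '' {q : P | ∃ f : q ⟶ p, L f}) : Set (PFilter P))) ∧
    (∀ J : GrothendieckTopology P,
      S J = {x : PFilter P | ∀ p : P, PFilter.principal p ≤ x → ∀ L ∈ J p,
        x ∈ upperClosure (PFilter.principal '' {q : P | ∃ f : q ⟶ p, L f})}) ∧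
    -- `K` is left adjoint to `S`
    GaloisConnection
      (fun Y : Set (PFilter P) => OrderDual.toDual (K Y))
      (fun J : (GrothendieckTopology P)ᵒᵈ => S (OrderDual.ofDual J)) ∧
    -- the adjunction restricts to an order isomorphism
    (∃ e : {Y : Set (PFilter P) // IsClosed[strongTopology (PFilter P)] Y} ≃o
        {J : GrothendieckTopology P // GrothendieckTopology.HasEnoughPoints.{u} J}ᵒᵈ,
      (∀ Y, (OrderDual.ofDual (e Y)).1 = K Y.1) ∧
      (∀ J, (e.symm J).1 = S (OrderDual.ofDual J).1)) ∧
    -- the images of `S` and `K`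
    Set.range (fun J : GrothendieckTopology P => S J) =
      {Y | IsClosed[strongTopology (PFilter P)] Y} ∧
    Set.range (fun Y : Set (PFilter P) => K Y) =
      {J | GrothendieckTopology.HasEnoughPoints.{u} J} ∧
    -- the subsets closed in the strong topology are the sober subspaces
    (∀ Y : Set (PFilter P),
      IsClosed[strongTopology (PFilter P)] Y ↔ (QuasiSober Y ∧ T0Space Y)) := by
  refine ⟨fun Y p L => ?_, fun J => ?_, gc_K_S,
    ⟨closedOrderIso P, fun _ => rfl, fun _ => rfl⟩, range_S, range_K, fun Y => ?_⟩
  · rw [mem_K_iff]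
    exact ⟨fun h y hy => mem_sieveOpen.2 (h y hy.2 (PFilter.principal_le_iff.1 hy.1)),
      fun h y hy hp => mem_sieveOpen.1 (h ⟨PFilter.principal_le_iff.2 hp, hy⟩)⟩
  · ext x
    rw [mem_S_iff]
    exact ⟨fun h p hp L hL => mem_sieveOpen.2 (h p (PFilter.principal_le_iff.1 hp) L hL),
      fun h p hp L hL => mem_sieveOpen.1 (h p (PFilter.principal_le_iff.2 hp) L hL)⟩
  · refine ⟨fun hY => ⟨quasiSober_of_S_K_eq (S_K_of_isClosed hY), inferInstance⟩, fun h => ?_⟩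
    have := h.1
    rw [← S_K_eq_of_quasiSober (Y := Y)]
    exact isClosed_strongTopology_S _
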